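/- Let $\overline{\mathbb Q}$ be an algebraic closure of $\mathbb Q$. Let $Y$ be the set of places $y$ of $\overline{\mathbb Q}$, and for $y\in Y$ let $\|\cdot\|_y$ be the absolute value in $y$ whose restriction to $\mathbb Q$ is the ordinary absolute value or a $p$-adic absolute value with $|p|=1/p$. For a number field $k\subseteq\overline{\mathbb Q}$ and a place $v$ of $k$ let $Y(k,v)$ be the set of places $y\in Y$ lying over $v$; give $Y$ the topology with the sets $Y(k,v)$ as a basis (it is locally compact, Hausdorff and totally disconnected). Let $\lambda$ be the Borel measure on $Y$, invariant under $\mathrm{Aut}(\overline{\mathbb Q}/\mathbb Q)$, with $\lambda(Y(k,v))=[k_v:\mathbb Q_v]/[k:\mathbb Q]$ for every number field $k$ and every place $v$ of $k$, where $k_v$ is the completion of $k$ at $v$ and $\mathbb Q_v$ is the completion of $\mathbb Q$ at the place below $v$. Explicitly, above each place $u$ of $\mathbb Q$, $\lambda$ is the image of the Haar probability measure of $\mathrm{Aut}(\overline{\mathbb Q}/\mathbb Q)$ under $\tau\mapsto\tau y_u$, for any place $y_u$ above $u$, where $\|x\|_{\tau y}=\|\tau^{-1}x\|_y$. For $\alpha\in\overline{\mathbb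 Q}^\times$ let $f_\alpha\in L^1(Y,\lambda)$ be the function $f_\alpha(y)=\log\|\alpha\|_y$, and put $$\mathcal F=\{f_\alpha:\alpha\in\overline{\mathbb Q}^\times\}\subseteq L^1(Y,\lambda),$$ a $\mathbb Q$-linear subspace of $L^1(Y,\lambda)$. (One has $\|f_\alpha\|_1=2h(\alpha)$, where $h$ is the absolute logarithmic Weil height.) For a field $K$ with $\mathbb Q\subseteq K\subseteq\overline{\mathbb Q}$ let $\mathcal F_K=\{f_\alpha:\alpha\in K^\times\}$ and $\mathcal D_K=\mathrm{span}_{\mathbb Q}\,\mathcal F_K$. A set $\mathcal S\subseteq\mathcal F$ is called $\mathcal F$-closed if $\mathcal S=\mathcal F\cap\overline{\mathcal S}$, where $\overline{\mathcal S}$ is the closure of $\mathcal S$ in the $L^1$-norm. **Theorem 2.2.** Let $K_1,\dots,K_N$ be fields with $\mathbb Q\subseteq K_n\subseteq\overline{\mathbb Q}$ for each $n$, and suppose that for each pair $n_1\neq n_2$ at least one of the extensions $K_{n_1}/(K_{n_1}\cap K_{n_2})$ and $K_{n_2}/(K_{n_1}\cap K_{n_2})$ is a (possibly infinite) Galois extension.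 Then the $\mathbb Q$-linear subspace $$\mathcal D_{K_1}+\mathcal D_{K_2}+\cdots+\mathcal D_{K_N}$$ is $\mathcal F$-closed. -/

import Mathlib

noncomputable section

namespace WeilHeight

open MeasureTheory

/-- A fixed algebraic closure of the rationals. -/
def QBar : Type := AlgebraicClosure ℚ

instance : Field QBar := inferInstanceAs (Field (AlgebraicClosure ℚ))

instance : CharZero QBar := inferInstanceAs (CharZero (AlgebraicClosure ℚ))

instance : IsAlgClosed QBar := inferInstanceAs (IsAlgClosed (AlgebraicClosure ℚ))

instance : Algebra.IsAlgebraic ℚ QBar := by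
  let A : Algebra ℚ QBar := inferInstanceAs (Algebra ℚ (AlgebraicClosure ℚ))
  have h : @Algebra.IsAlgebraic ℚ QBar _ _ A := AlgebraicClosure.isAlgebraic ℚ
  exact (Subsingleton.elim A DivisionRing.toRatAlgebra) ▸ h

instance : IsAlgClosure ℚ QBar := ⟨inferInstance, inferInstance⟩

/-- The absolute Galois group `Aut(QBar / ℚ)`, a profinite group with the Krull topology. -/
abbrev AbsGal : Type := QBar ≃ₐ[ℚ] QBar

/-- The places of `ℚ`: `none` is the infinite place, `some p` the `p`-adic one. -/
abbrev RatPlace : Type := Option Nat.Primes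

/-- The usual absolute value of `ℚ` at a place: the ordinary one at the infinite place, the
`p`-adic one with `|p| = 1 / p` at the prime `p`. -/
def ratAbs : RatPlace → AbsoluteValue ℚ ℝ
  | none => Rat.AbsoluteValue.real
  | some p => haveI : Fact (p : ℕ).Prime := ⟨p.2⟩; Rat.AbsoluteValue.padic p

/-- The set `Y` of places of `QBar`. A place (an equivalence class of nontrivial absolute values) is
represented by its unique normalized member `‖ ‖_y`, the one whose restriction to `ℚ` is one of the
usual absolute values of `ℚ`. -/
def Place : Type :=
  {y : AbsoluteValue QBar ℝ // ∃ u : RatPlace, ∀ q : ℚ, y (algebraMap ℚ QBar q) = ratAbs u q}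

namespace Place

/-- `y.abv x` is `‖x‖_y`. -/
def abv (y : Place) : AbsoluteValue QBar ℝ := y.1

/-- The set `Y(k, v)` of places of `QBar` lying over the place `v` of the subfield `k`, where `v` is
given as the restriction to `k` of a place `y` of `QBar`. -/
def cylinder (k : IntermediateField ℚ QBar) (y : Place) : Set Place :=
  {z | ∀ x ∈ k, z.abv x = y.abv x}

/-- The topology of `Y`: a basis consists of the sets `Y(k, v)` for number fields `k` and places `v`
of `k`. On every `Y(k, v)` it is the topology of the inverse limit, over the finite extensions
`l / k`, of the finite discrete sets of places of `l` above `v`. -/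
instance : TopologicalSpace Place :=
  TopologicalSpace.generateFrom
    {U | ∃ (k : IntermediateField ℚ QBar) (y : Place), FiniteDimensional ℚ k ∧ U = cylinder k y}

/-- The Borel sets of `Y`. -/
instance : MeasurableSpace Place := borel Place

instance : BorelSpace Place := ⟨rfl⟩

/-- The Galois action on places, `‖x‖_{τ y} = ‖τ⁻¹ x‖_y`. -/
def act (τ : AbsGal) (y : Place) : Place :=
  ⟨y.abv.comp (f := ((τ.symm : QBar ≃ₐ[ℚ] QBar) : QBar →+* QBar)) τ.symm.injective, by
    obtain ⟨u, hu⟩ := y.2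
    refine ⟨u, fun q => ?_⟩
    rw [← hu q]
    exact congrArg y.1 (τ.symm.commutes q)⟩

theorem act_abv (τ : AbsGal) (y : Place) (x : QBar) :
    (act τ y).abv x = y.abv (τ.symm x) := rfl

/-- A place of `QBar` over the infinite place of `ℚ`, from an embedding of `QBar` into `ℂ`. -/
def baseInfinite : Place :=
  ⟨(NormedField.toAbsoluteValue ℂ).comp
      (f := ((IsAlgClosed.lift : QBar →ₐ[ℚ] ℂ) : QBar →+* ℂ)) (RingHom.injective _), none, by
    intro q
    show ‖(IsAlgClosed.lift : QBar →ₐ[ℚ] ℂ) (algebraMap ℚ QBar q)‖ = _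
    rw [AlgHom.commutes]
    simp [ratAbs]⟩

/-- A place of `QBar` over the prime `p`, from an embedding of `QBar` into an algebraic closure of
the `p`-adic numbers. -/
def baseFinite (p : Nat.Primes) : Place :=
  haveI : Fact (p : ℕ).Prime := ⟨p.2⟩
  ⟨(NormedField.toAbsoluteValue (PadicAlgCl p)).comp
      (f := ((IsAlgClosed.lift : QBar →ₐ[ℚ] PadicAlgCl p) : QBar →+* PadicAlgCl p))
      (RingHom.injective _), some p, by
    intro q
    show ‖(IsAlgClosed.lift : QBar →ₐ[ℚ] PadicAlgCl p) (algebraMap ℚ QBar q)‖ = _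
    rw [AlgHom.commutes, eq_ratCast, ← map_ratCast (algebraMap ℚ_[p] (PadicAlgCl p)) q]
    exact (PadicAlgCl.norm_extends p q).trans (Padic.eq_padicNorm q)⟩

/-- A place of `QBar` over a given place of `ℚ`. -/
def base : RatPlace → Place
  | none => baseInfinite
  | some p => baseFinite p

theorem base_over (u : RatPlace) (q : ℚ) : (base u).abv (algebraMap ℚ QBar q) = ratAbs u q := by
  cases u with
  | none =>
    show ‖(IsAlgClosed.lift : QBar →ₐ[ℚ] ℂ) (algebraMap ℚ QBar q)‖ = _
    rw [AlgHom.commutes]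
    simp [ratAbs]
  | some p =>
    have : Fact (p : ℕ).Prime := ⟨p.2⟩
    show ‖(IsAlgClosed.lift : QBar →ₐ[ℚ] PadicAlgCl p) (algebraMap ℚ QBar q)‖ = _
    rw [AlgHom.commutes, eq_ratCast, ← map_ratCast (algebraMap ℚ_[p] (PadicAlgCl p)) q]
    exact (PadicAlgCl.norm_extends p q).trans (Padic.eq_padicNorm q)

end Place

instance : MeasurableSpace AbsGal := borel AbsGal

instance : BorelSpace AbsGal := ⟨rfl⟩

/-- The Haar probability measure of the absolute Galois group. -/
def galHaar : Measure AbsGal := Measure.haarMeasure ⊤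

/-- The normalized Galois-invariant measure `λ` on `Y`. Over each place `u` of `ℚ` it is the image of
the Haar probability measure of the absolute Galois group under the orbit map `τ ↦ τ y_u` of a place
`y_u` above `u`; the group acts transitively on the places above `u`, so the choice of `y_u` does
not matter. By invariance and total mass `1` over every `u`, for a number field `k` and a
place `v` of `k` above `u`, `λ(Y(k, v)) = [k_v : ℚ_u] / [k : ℚ]`. -/
def placeMeasure : Measure Place :=
  Measure.sum fun u : RatPlace => galHaar.map fun τ => Place.act τ (Place.base u)

/-- The real Banach space `L¹(Y, λ)`. -/
abbrev L1 : Type := Lp ℝ 1 placeMeasure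


namespace Place

theorem isOpen_cylinder (k : IntermediateField ℚ QBar) [FiniteDimensional ℚ k] (y : Place) :
    IsOpen (cylinder k y) :=
  TopologicalSpace.isOpen_generateFrom_of_mem ⟨k, y, inferInstance, rfl⟩

theorem continuous_act_left (y : Place) : Continuous fun τ : AbsGal => act τ y := by
  refine continuous_generateFrom_iff.2 ?_
  rintro _ ⟨k, z, hk, rfl⟩
  have : {τ : AbsGal | ∀ x ∈ k, y.abv (τ.symm x) = z.abv x} =
    (fun τ : AbsGal => act τ y) ⁻¹' cylinder k z := rfl
  rw [← this, isOpen_iff_mem_nhds]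
  intro τ hτ
  have hU : (k.fixingSubgroup : Set AbsGal) ∈ nhds (1 : AbsGal) :=
    (IntermediateField.fixingSubgroup_isOpen k).mem_nhds (one_mem _)
  have hc : Filter.Tendsto (fun σ : AbsGal => σ * τ⁻¹) (nhds τ) (nhds (1 : AbsGal)) := by
    have h : Continuous (fun σ : AbsGal => σ * τ⁻¹) := by fun_prop
    simpa using h.tendsto τ
  filter_upwards [hc hU] with σ hσ x hx
  have h1 : σ (τ.symm x) = x := hσ ⟨x, hx⟩
  have h2 : σ.symm x = τ.symm x := by rw [AlgEquiv.symm_apply_eq, h1]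
  rw [h2]
  exact hτ x hx

end Place

/-- `f_α(y) = log ‖α‖_y`. -/
def logAbs (α : QBarˣ) (y : Place) : ℝ := Real.log (y.abv α)

theorem continuous_logAbs (α : QBarˣ) : Continuous (logAbs α) := by
  refine IsLocallyConstant.continuous (IsLocallyConstant.iff_exists_open _ |>.2 fun y => ?_)
  have : FiniteDimensional ℚ (IntermediateField.adjoin ℚ {(α : QBar)}) :=
    IntermediateField.adjoin.finiteDimensional (Algebra.IsIntegral.isIntegral _)
  refine ⟨_, Place.isOpen_cylinder (IntermediateField.adjoin ℚ {(α : QBar)}) y, fun _ _ => rfl, ?_⟩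
  intro z hz
  exact congrArg Real.log (hz α (IntermediateField.mem_adjoin_simple_self ℚ _))


theorem base_le_one (p : Nat.Primes) {x : QBar} (hx : IsIntegral ℤ x) :
    (Place.base (some p)).abv x ≤ 1 := by
  have : Fact (p : ℕ).Prime := ⟨p.2⟩
  have h1 : IsIntegral ℤ ((IsAlgClosed.lift : QBar →ₐ[ℚ] PadicAlgCl p) x) :=
    map_isIntegral_int (IsAlgClosed.lift : QBar →ₐ[ℚ] PadicAlgCl p).toRingHom hx
  have h2 := (Valuation.integer.integers
    (Valued.v : Valuation (PadicAlgCl p) NNReal)).mem_of_integral h1.tower_top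
  exact h2

theorem exists_nat_isIntegral (x : QBar) : ∃ n : ℕ, n ≠ 0 ∧ IsIntegral ℤ ((n : QBar) * x) := by
  have hx : IsAlgebraic ℤ x :=
    (IsFractionRing.isAlgebraic_iff ℤ ℚ QBar).2 (Algebra.IsAlgebraic.isAlgebraic x)
  obtain ⟨m, hm, h⟩ := hx.exists_integral_multiple
  refine ⟨m.natAbs, by simpa using hm, ?_⟩
  rcases Int.natAbs_eq m with e | e
  · rw [e] at h
    simpa using h
  · rw [e] at h
    simpa using h.neg

theorem base_natCast (p : Nat.Primes) {n : ℕ} (hn : ¬ (p : ℕ) ∣ n) :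
    (Place.base (some p)).abv (n : QBar) = 1 := by
  have : Fact (p : ℕ).Prime := ⟨p.2⟩
  have h := Place.base_over (some p) (n : ℚ)
  rw [map_natCast] at h
  rw [h]
  show ((padicNorm p (n : ℚ) : ℚ) : ℝ) = 1
  rw [padicNorm.nat_eq_one_iff _ |>.2 hn, Rat.cast_one]

theorem logAbs_act_base_eq_zero (α : QBarˣ) :
    ∃ n : ℕ, n ≠ 0 ∧ ∀ (p : Nat.Primes), ¬ (p : ℕ) ∣ n → ∀ τ : AbsGal,
      logAbs α (Place.act τ (Place.base (some p))) = 0 := by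
  obtain ⟨n, hn, h⟩ := exists_nat_isIntegral (α : QBar)
  obtain ⟨m, hm, h'⟩ := exists_nat_isIntegral ((α⁻¹ : QBarˣ) : QBar)
  refine ⟨n * m, mul_ne_zero hn hm, fun p hp τ => ?_⟩
  have key : ∀ (x : QBar) (k : ℕ), ¬ (p : ℕ) ∣ k → IsIntegral ℤ ((k : QBar) * x) →
      (Place.base (some p)).abv (τ.symm x) ≤ 1 := by
    intro x k hk hx
    have h1 := base_le_one p (map_isIntegral_int τ.symm.toAlgHom.toRingHom hx)
    have h2 : τ.symm.toAlgHom.toRingHom ((k : QBar) * x) = (k : QBar) * τ.symm x := by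
      simp
    rwa [h2, map_mul, base_natCast p hk, one_mul] at h1
  have h1 := key _ n (fun hd => hp (hd.mul_right m)) h
  have h2 := key _ m (fun hd => hp (hd.mul_left n)) h'
  have h3 : (Place.base (some p)).abv (τ.symm (α : QBar)) *
      (Place.base (some p)).abv (τ.symm ((α⁻¹ : QBarˣ) : QBar)) = 1 := by
    rw [← map_mul, ← map_mul, Units.mul_inv, map_one, map_one]
  have h0 := (Place.base (some p)).abv.nonneg (τ.symm (α : QBar))
  have h4 : (Place.base (some p)).abv (τ.symm (α : QBar)) = 1 := by nlinarith
  rw [logAbs, Place.act_abv, h4, Real.log_one]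

instance : IsFiniteMeasure galHaar := by
  unfold galHaar; infer_instance

theorem integrable_logAbs (α : QBarˣ) : Integrable (logAbs α) placeMeasure := by
  refine ⟨(continuous_logAbs α).measurable.aestronglyMeasurable, ?_⟩
  have hmeas : Measurable fun y => ‖logAbs α y‖ₑ := (continuous_logAbs α).measurable.enorm
  rw [HasFiniteIntegral, placeMeasure, lintegral_sum_measure]
  have hf : ∀ u : RatPlace, ∫⁻ y, ‖logAbs α y‖ₑ
      ∂(galHaar.map fun τ => Place.act τ (Place.base u)) < ⊤ := by
    intro u
    rw [lintegral_map hmeas (Place.continuous_act_left _).measurable]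
    exact (((continuous_logAbs α).comp
      (Place.continuous_act_left (Place.base u))).integrable_of_hasCompactSupport
      (HasCompactSupport.of_compactSpace _) (μ := galHaar)).2
  obtain ⟨n, hn, h⟩ := logAbs_act_base_eq_zero α
  let s : Finset RatPlace := insert none
    ((n.primeFactors.subtype Nat.Prime).image fun p => some p)
  rw [tsum_eq_sum (s := s)]
  · exact ENNReal.sum_lt_top.2 fun u _ => hf u
  · intro u hu
    rw [lintegral_map hmeas (Place.continuous_act_left _).measurable]
    rcases u with _ | p
    · exact absurd (Finset.mem_insert_self _ _) hu
    · have hp : ¬ (p : ℕ) ∣ n := fun hd => hu (Finset.mem_insert_of_mem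
        (Finset.mem_image.2 ⟨p,
          Finset.mem_subtype.2 (Nat.mem_primeFactors.2 ⟨p.2, hd, hn⟩), rfl⟩))
      simp [h p hp]

theorem memLp_logAbs (α : QBarˣ) : MemLp (logAbs α) 1 placeMeasure :=
  memLp_one_iff_integrable.2 (integrable_logAbs α)


theorem Place.continuous_act (τ : AbsGal) : Continuous (Place.act τ) := by
  refine continuous_generateFrom_iff.2 ?_
  rintro _ ⟨k, z, hk, rfl⟩
  have hfd : FiniteDimensional ℚ (k.map (τ.symm : QBar →ₐ[ℚ] QBar)) :=
    LinearEquiv.finiteDimensional (k.equivMap (τ.symm : QBar →ₐ[ℚ] QBar)).toLinearEquiv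
  have : Place.act τ ⁻¹' Place.cylinder k z =
      Place.cylinder (k.map (τ.symm : QBar →ₐ[ℚ] QBar)) (Place.act τ.symm z) := by
    ext y
    constructor
    · rintro h _ ⟨x, hx, rfl⟩
      have := h x hx
      rw [Place.act_abv] at this ⊢
      simpa using this
    · intro h x hx
      have := h (τ.symm x) ⟨x, hx, rfl⟩
      rw [Place.act_abv] at this ⊢
      simpa using this
  rw [this]
  exact Place.isOpen_cylinder _ _

/-- The Galois action preserves `placeMeasure`. -/
theorem map_act_placeMeasure (τ : AbsGal) :
    placeMeasure.map (Place.act τ) = placeMeasure := by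
  have : Measure.IsHaarMeasure galHaar := by unfold galHaar; infer_instance
  have hm := (Place.continuous_act τ).measurable
  rw [placeMeasure, Measure.map_sum hm.aemeasurable]
  congr 1
  funext u
  have hb := (Place.continuous_act_left (Place.base u)).measurable
  rw [Measure.map_map hm hb]
  conv_rhs => rw [← map_mul_left_eq_self galHaar τ,
    Measure.map_map hb (continuous_const_mul τ).measurable]
  rfl

theorem ratAbs_injective : Function.Injective fun (u : RatPlace) (q : ℚ) => ratAbs u q := by
  have h1 : ∀ p : Nat.Primes, ratAbs (some p) ((p : ℕ) : ℚ) < 1 := by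
    intro p
    have : Fact (p : ℕ).Prime := ⟨p.2⟩
    show ((padicNorm p ((p : ℕ) : ℚ) : ℚ) : ℝ) < 1
    exact_mod_cast padicNorm.padicNorm_p_lt_one_of_prime
  have h2 : ∀ p q : Nat.Primes, p ≠ q → ratAbs (some p) ((q : ℕ) : ℚ) = 1 := by
    intro p q hpq
    have : Fact (p : ℕ).Prime := ⟨p.2⟩
    show ((padicNorm p ((q : ℕ) : ℚ) : ℚ) : ℝ) = 1
    rw [(padicNorm.nat_eq_one_iff _).2, Rat.cast_one]
    intro h
    exact hpq (Subtype.ext ((Nat.prime_dvd_prime_iff_eq p.2 q.2).1 h))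
  have h3 : ∀ p : Nat.Primes, 1 ≤ ratAbs none ((p : ℕ) : ℚ) := by
    intro p
    have : (1 : ℝ) ≤ (p : ℕ) := by exact_mod_cast p.2.one_lt.le
    simpa [ratAbs] using this
  rintro (_ | p) (_ | q) h
  · rfl
  · exact absurd (congrFun h ((q : ℕ) : ℚ)) (by have := h1 q; have := h3 q; simp only; linarith)
  · exact absurd (congrFun h ((p : ℕ) : ℚ)) (by have := h1 p; have := h3 p; simp only; linarith)
  · by_contra hne
    have := congrFun h ((q : ℕ) : ℚ)
    simp only at this
    rw [h2 p q (fun e => hne (by rw [e]))] at this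
    linarith [h1 q]

/-- `λ(Y(ℚ, u)) = 1`. -/
theorem placeMeasure_cylinder_bot (u : RatPlace) :
    placeMeasure (Place.cylinder ⊥ (Place.base u)) = 1 := by
  have hms := (Place.isOpen_cylinder ⊥ (Place.base u)).measurableSet
  rw [placeMeasure, Measure.sum_apply _ hms, tsum_eq_single u]
  · rw [Measure.map_apply (Place.continuous_act_left _).measurable hms]
    have : (fun τ => Place.act τ (Place.base u)) ⁻¹' Place.cylinder ⊥ (Place.base u) =
        ((⊤ : TopologicalSpace.PositiveCompacts AbsGal) : Set AbsGal) := by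
      ext τ
      simp only [Set.mem_preimage, TopologicalSpace.PositiveCompacts.coe_top, Set.mem_univ,
        iff_true]
      intro x hx
      obtain ⟨q, rfl⟩ := IntermediateField.mem_bot.1 hx
      rw [Place.act_abv, AlgEquiv.commutes]
    rw [this]
    exact Measure.haarMeasure_self
  · intro v hv
    rw [Measure.map_apply (Place.continuous_act_left _).measurable hms]
    have : (fun τ => Place.act τ (Place.base v)) ⁻¹' Place.cylinder ⊥ (Place.base u) = ∅ := by
      ext τ
      simp only [Set.mem_preimage, Set.mem_empty_iff_false, iff_false]
      intro h
      refine hv (ratAbs_injective (funext fun q => ?_))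
      have := h (algebraMap ℚ QBar q) (IntermediateField.algebraMap_mem _ q)
      rwa [Place.act_abv, AlgEquiv.commutes, Place.base_over, Place.base_over] at this
    rw [this, measure_empty]

/-- The function `f_α` as an element of `L¹(Y, λ)`. It depends only on the class of `α` modulo
roots of unity. -/
def toL1 (α : QBarˣ) : L1 := (memLp_logAbs α).toLp (logAbs α)

/-- `𝓕`, the set of all functions `f_α`. -/
def heightFunctions : Set L1 := Set.range toL1

/-- `𝓕_K`, the set of the functions `f_α` with `α ∈ Kˣ`. -/
def heightFunctionsOf (K : IntermediateField ℚ QBar) : Set L1 :=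
  {F | ∃ α : QBarˣ, (α : QBar) ∈ K ∧ F = toL1 α}

/-- `𝓓_K`, the `ℚ`-linear span of `𝓕_K`. -/
def heightSpan (K : IntermediateField ℚ QBar) : Submodule ℚ L1 :=
  Submodule.span ℚ (heightFunctionsOf K)

/-- A subset `S` of `𝓕` is `𝓕`-closed if `S = 𝓕 ∩ closure S`, with the closure in `L¹`-norm. (The
functions in `𝓕` have integral zero, and the functions with integral zero form a closed subspace of
`L¹(Y, λ)`, so the closures in that subspace and in `L¹(Y, λ)` are the same.) -/
def IsHeightClosed (S : Set L1) : Prop := S = heightFunctions ∩ closure S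

end WeilHeight

end

/-! The space `𝓕` is a `ℚ`-vector space on which the absolute Galois group acts by isometries, `τ
f_α = f_{τα}`, and every orbit is finite because an algebraic number has finitely many conjugates.
Averaging over the orbits of `Aut(QBar / K)` therefore needs no integration: it is a linear
idempotent `P_K` of `𝓕` of norm at most one. The range of `P_K` is `𝓓_K`. Indeed `P_K f_α` is a
rational multiple of `f_β`, where `β` is the product of the conjugates of `α` over `K` and so lies
in `K`, while `f_α` is already fixed when `α ∈ K` (`map_range_fieldProjection`). If one of two
fields is Galois over the intersection, its fixing group is normalized by that of the other field,
and the two averages commute (`orbitAverage_comm`). For commuting continuous projections, the sum of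
the ranges is the kernel of the continuous operator `∏ (1 - P_i)`, hence closed in `𝓕`
(`isClosed_iSup_range_of_commute`). Relative closedness in `𝓕` is exactly what being `𝓕`-closed
means for a subspace of `𝓕`. -/

open MulAction

/-- Averaging a function pulled back along an equivariant map of finite transitive `G`-sets gives
the average of the function itself. -/
theorem average_comp_equivariant {G X Y V : Type*} [Group G] [MulAction G X] [MulAction G Y]
    [IsPretransitive G X] [IsPretransitive G Y] [Fintype X] [Fintype Y] [Nonempty X]
    [AddCommGroup V] [Module ℚ V] (π : X → Y) (hπ : ∀ (g : G) x, π (g • x) = g • π x)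
    (f : Y → V) :
    (Fintype.card X : ℚ)⁻¹ • ∑ x, f (π x) = (Fintype.card Y : ℚ)⁻¹ • ∑ y, f y := by
  classical
  obtain ⟨x₀⟩ := ‹Nonempty X›
  set c := (Finset.univ.filter fun x => π x = π x₀).card with hc
  -- By transitivity all fibres of `π` are translates of each other, so `c` is their common size.
  have hfib : ∀ y : Y, (Finset.univ.filter fun x => π x = y).card = c := by
    intro y
    obtain ⟨g, rfl⟩ := exists_smul_eq G (π x₀) y
    refine Finset.card_bij' (fun x _ => g⁻¹ • x) (fun x _ => g • x) ?_ ?_ ?_ ?_ <;>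
      simp +contextual [hπ]
  have hcard : Fintype.card X = Fintype.card Y * c := by
    rw [← Finset.card_univ, Finset.card_eq_sum_card_fiberwise (f := π) (t := Finset.univ)
      (fun _ _ => Finset.mem_coe.2 (Finset.mem_univ _)), Finset.sum_congr rfl fun y _ => hfib y]
    simp
  have hsum : ∑ x, f (π x) = (c : ℚ) • ∑ y, f y := by
    rw [← Finset.sum_fiberwise_of_maps_to (g := π) (t := Finset.univ) (fun _ _ => Finset.mem_univ _),
      Finset.smul_sum]
    refine Finset.sum_congr rfl fun y _ => ?_
    rw [Finset.sum_congr rfl fun x hx => by rw [(Finset.mem_filter.1 hx).2], Finset.sum_const,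
      hfib, Nat.cast_smul_eq_nsmul]
  have hc0 : (c : ℚ) ≠ 0 := by
    have : 0 < c := Finset.card_pos.2 ⟨x₀, by simp⟩
    positivity
  rw [hsum, smul_smul, hcard, Nat.cast_mul, mul_inv, mul_assoc, inv_mul_cancel₀ hc0, mul_one]

/-! ### Averages over finite orbits -/

section OrbitAverage

variable (G : Type*) {V : Type*} [Group G] [AddCommGroup V] [Module ℚ V] [DistribMulAction G V]

/-- The average of the orbit of a vector (a junk value if the orbit is infinite). -/
noncomputable def orbitAverage (v : V) : V :=
  (Nat.card (orbit G v) : ℚ)⁻¹ • ∑ᶠ w : orbit G v, (w : V)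

variable {G}

/-- The map `f` sends `X` equivariantly onto the orbit of `f x₀`. This allows an orbit average to be
computed over any finite transitive index set, in particular over one shared by several vectors. -/
theorem average_eq_orbitAverage {X : Type*} [MulAction G X] [IsPretransitive G X] [Fintype X]
    (f : X → V) (hf : ∀ (g : G) x, f (g • x) = g • f x) (x₀ : X) :
    (Fintype.card X : ℚ)⁻¹ • ∑ x, f x = orbitAverage G (f x₀) := by
  have hmem : ∀ x, f x ∈ orbit G (f x₀) := fun x => by
    obtain ⟨g, rfl⟩ := exists_smul_eq G x₀ x
    exact ⟨g, (hf g x₀).symm⟩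
  let π : X → orbit G (f x₀) := fun x => ⟨f x, hmem x⟩
  have hsurj : Function.Surjective π := by
    rintro ⟨_, g, rfl⟩
    exact ⟨g • x₀, Subtype.ext (hf g x₀)⟩
  have := Finite.of_surjective π hsurj
  have := Fintype.ofFinite (orbit G (f x₀))
  have : Nonempty X := ⟨x₀⟩
  rw [orbitAverage, finsum_eq_sum_of_fintype, Nat.card_eq_fintype_card]
  exact average_comp_equivariant π (fun g x => Subtype.ext (hf g x)) fun w => (w : V)

theorem orbitAverage_eq_sum (v : V) [Fintype (orbit G v)] :
    orbitAverage G v = (Fintype.card (orbit G v) : ℚ)⁻¹ • ∑ w : orbit G v, (w : V) := by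
  rw [orbitAverage, finsum_eq_sum_of_fintype, Nat.card_eq_fintype_card]

theorem orbitAverage_of_fixed {v : V} (hv : ∀ g : G, g • v = v) : orbitAverage G v = v := by
  -- A fixed vector is an equivariant map from a point with trivial action.
  let _ : MulAction G Unit := { smul := fun _ x => x, one_smul := fun _ => rfl, mul_smul := fun _ _ _ => rfl }
  rw [← average_eq_orbitAverage (G := G) (fun _ : Unit => v) (fun g _ => (hv g).symm) ()]
  simp

theorem orbitAverage_map {φ : V →+ V} (hφ : ∀ (g : G) v, φ (g • v) = g • φ v)
    (hfin : ∀ v : V, (orbit G v).Finite) (v : V) :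
    orbitAverage G (φ v) = φ (orbitAverage G v) := by
  have := (hfin v).fintype
  rw [← average_eq_orbitAverage (fun w : orbit G v => φ w) (fun g w => hφ g w)
    ⟨v, mem_orbit_self v⟩, orbitAverage_eq_sum, map_inv_natCast_smul φ ℚ ℚ, map_sum]

theorem smul_orbitAverage (hfin : ∀ v : V, (orbit G v).Finite) (g : G) (v : V) :
    g • orbitAverage G v = orbitAverage G v := by
  have := (hfin v).fintype
  rw [orbitAverage_eq_sum, ← DistribSMul.toAddMonoidHom_apply, map_inv_natCast_smul _ ℚ ℚ, map_sum]
  congr 1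
  exact Equiv.sum_comp (MulAction.toPerm g : Equiv.Perm (orbit G v)) fun w => (w : V)

/-- The orbits of `v`, `w` and `v + w` may have different sizes. All three are equivariant images of
the orbit of the pair `(v, w)`, which is finite inside the product of the two orbits, so the three
averages can be taken over it. -/
theorem orbitAverage_add (hfin : ∀ v : V, (orbit G v).Finite) (v w : V) :
    orbitAverage G (v + w) = orbitAverage G v + orbitAverage G w := by
  have hX : (orbit G (v, w)).Finite := ((hfin v).prod (hfin w)).subset <| by
    rintro _ ⟨g, rfl⟩
    exact ⟨⟨g, rfl⟩, ⟨g, rfl⟩⟩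
  have := hX.fintype
  let x₀ : orbit G (v, w) := ⟨(v, w), mem_orbit_self _⟩
  have h1 : _ = orbitAverage G v := average_eq_orbitAverage
    (fun x : orbit G (v, w) => x.1.1) (fun _ _ => by rw [orbit.coe_smul, Prod.smul_fst]) x₀
  have h2 : _ = orbitAverage G w := average_eq_orbitAverage
    (fun x : orbit G (v, w) => x.1.2) (fun _ _ => by rw [orbit.coe_smul, Prod.smul_snd]) x₀
  have h3 : _ = orbitAverage G (v + w) := average_eq_orbitAverage
    (fun x : orbit G (v, w) => x.1.1 + x.1.2)
    (fun _ _ => by rw [orbit.coe_smul, Prod.smul_fst, Prod.smul_snd, smul_add]) x₀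
  rw [← h1, ← h2, ← h3, ← smul_add, Finset.sum_add_distrib]

variable (G) in
/-- Averaging over orbits as a linear projection. -/
noncomputable def orbitAverageLinear (hfin : ∀ v : V, (orbit G v).Finite) : V →ₗ[ℚ] V :=
  AddMonoidHom.toRatLinearMap
    { toFun := orbitAverage G
      map_zero' := orbitAverage_of_fixed fun g => smul_zero g
      map_add' := fun v w => orbitAverage_add (G := G) hfin v w }

end OrbitAverage

theorem norm_orbitAverage_le {G V : Type*} [Group G] [NormedAddCommGroup V] [NormedSpace ℚ V]
    [DistribMulAction G V] (hfin : ∀ v : V, (orbit G v).Finite)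
    (hiso : ∀ (g : G) (v : V), ‖g • v‖ = ‖v‖) (v : V) : ‖orbitAverage G v‖ ≤ ‖v‖ := by
  have := (hfin v).fintype
  have hpos : (0 : ℝ) < Fintype.card (orbit G v) := by
    exact_mod_cast Fintype.card_pos_iff.2 (⟨⟨v, mem_orbit_self v⟩⟩ : Nonempty (orbit G v))
  have hle : ‖∑ w : orbit G v, (w : V)‖ ≤ Fintype.card (orbit G v) * ‖v‖ := by
    refine (norm_sum_le _ _).trans_eq ?_
    rw [Finset.sum_congr rfl (g := fun _ => ‖v‖)]
    · simp
    · rintro ⟨_, g, rfl⟩ _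
      exact hiso g v
  rw [orbitAverage_eq_sum, norm_smul, norm_inv]
  have : ‖(Fintype.card (orbit G v) : ℚ)‖ = Fintype.card (orbit G v) := by
    rw [← Rat.norm_cast_real]
    simp
  rw [this, inv_mul_le_iff₀ hpos]
  exact hle

/-- Since `k h = (k h k⁻¹) k`, translation by a normalizing `k` is a bijection from the `H`-orbit of
`v` to that of `k • v`. -/
theorem orbitAverage_smul_of_mem_normalizer {G V : Type*} [Group G] [AddCommGroup V] [Module ℚ V]
    [DistribMulAction G V] (H : Subgroup G) {k : G} (hk : k ∈ Subgroup.normalizer (H : Set G))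
    (hH : ∀ v : V, (orbit H v).Finite) (v : V) :
    orbitAverage H (k • v) = k • orbitAverage H v := by
  rw [Subgroup.mem_normalizer_iff] at hk
  have hmem : ∀ w : V, w ∈ orbit H v ↔ k • w ∈ orbit H (k • v) := by
    intro w
    constructor
    · rintro ⟨h, rfl⟩
      exact ⟨⟨k * h * k⁻¹, (hk h).1 h.2⟩, by simp [Subgroup.smul_def, mul_smul]⟩
    · rintro ⟨h, hh⟩
      refine ⟨⟨k⁻¹ * h * k, (hk _).2 (by simp [mul_assoc])⟩, ?_⟩
      simp only [Subgroup.smul_def] at hh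
      simp [Subgroup.smul_def, mul_smul, hh]
  let e : orbit H v ≃ orbit H (k • v) := (MulAction.toPerm k).subtypeEquiv hmem
  have := (hH v).fintype
  rw [orbitAverage_eq_sum v, orbitAverage, ← Nat.card_congr e, Nat.card_eq_fintype_card,
    ← finsum_comp_equiv e, finsum_eq_sum_of_fintype,
    ← DistribSMul.toAddMonoidHom_apply V k (_ • _), map_inv_natCast_smul _ ℚ ℚ, map_sum]
  rfl

/-- Averages over two subgroups commute if one of them normalizes the other. -/
theorem orbitAverage_comm {G V : Type*} [Group G] [AddCommGroup V] [Module ℚ V]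
    [DistribMulAction G V] (H K : Subgroup G) (hnorm : K ≤ Subgroup.normalizer (H : Set G))
    (hH : ∀ v : V, (orbit H v).Finite) (hK : ∀ v : V, (orbit K v).Finite) (v : V) :
    orbitAverage K (orbitAverage H v) = orbitAverage H (orbitAverage K v) :=
  -- Averaging over `H` is itself a `K`-equivariant additive map.
  orbitAverage_map (G := K) (φ := (orbitAverageLinear H hH).toAddMonoidHom)
    (fun k w => orbitAverage_smul_of_mem_normalizer H (hnorm k.2) hH w) hK v

/-! ### Sums of ranges of commuting projections -/

/-- The sum of the ranges of finitely many commuting continuous projections is closed. -/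
theorem isClosed_iSup_range_of_commute {ι R V : Type*} [Finite ι] [Ring R] [AddCommGroup V]
    [Module R V] [TopologicalSpace V] [IsTopologicalAddGroup V] [T1Space V]
    (T : ι → Module.End R V) (hcont : ∀ i, Continuous (T i)) (hidem : ∀ i, IsIdempotentElem (T i))
    (hcomm : ∀ i j, Commute (T i) (T j)) :
    IsClosed ((⨆ i, LinearMap.range (T i) : Submodule R V) : Set V) := by
  have := Fintype.ofFinite ι
  let P : List ι → Module.End R V := fun l => (l.map fun i => 1 - T i).prod
  have hP : ∀ i l, P (i :: l) = (1 - T i) * P l := fun i l => List.prod_cons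
  have hPc : ∀ l, Continuous (P l) := by
    intro l
    induction l with
    | nil => exact continuous_id
    | cons i l ih =>
      rw [hP]
      exact (continuous_id.sub (hcont i)).comp ih
  have hPcomm : ∀ l i, Commute (P l) (T i) := fun l i =>
    Commute.list_prod_left _ _ <| by
      simp only [List.mem_map]
      rintro _ ⟨j, _, rfl⟩
      exact (Commute.one_left _).sub_left (hcomm j i)
  have hPkill : ∀ l, ∀ i ∈ l, P l * T i = 0 := by
    intro l
    induction l with
    | nil => simp
    | cons j l ih =>
      intro i hi
      rw [hP, mul_assoc]
      rcases List.mem_cons.1 hi with rfl | hi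
      · rw [(hPcomm l i).eq, ← mul_assoc, sub_mul, one_mul, (hidem i).eq, sub_self, zero_mul]
      · rw [ih i hi, mul_zero]
  -- Removing the factors `1 - T j` one at a time writes `v - P l v` as a sum of vectors in the
  -- ranges, so a vector killed by `P l` lies in their sum.
  have hPsub : ∀ l v, v - P l v ∈ (⨆ i, LinearMap.range (T i) : Submodule R V) := by
    intro l v
    induction l with
    | nil => simp [P]
    | cons j l ih =>
      have : v - P (j :: l) v = (v - P l v) + T j (P l v) := by
        rw [hP]
        simp [sub_add]
      rw [this]
      exact add_mem ih (Submodule.mem_iSup_of_mem j ⟨_, rfl⟩)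
  let l := (Finset.univ : Finset ι).toList
  have heq : ((⨆ i, LinearMap.range (T i) : Submodule R V) : Set V) = P l ⁻¹' {0} := by
    refine Set.Subset.antisymm ?_ fun v hv => ?_
    · change (⨆ i, LinearMap.range (T i)) ≤ LinearMap.ker (P l)
      refine iSup_le fun i => ?_
      rintro _ ⟨v, rfl⟩
      exact LinearMap.congr_fun (hPkill l i (by simp [l])) v
    · have h := hPsub l v
      rwa [Set.mem_singleton_iff.1 hv, sub_zero] at h
  rw [heq]
  exact isClosed_singleton.preimage (hPc l)

/-! ### The space of height functions and its Galois action -/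

namespace WeilHeight

open MeasureTheory

attribute [local instance] Units.mulDistribMulActionRight

theorem measurePreserving_act (τ : AbsGal) :
    MeasurePreserving (Place.act τ) placeMeasure placeMeasure :=
  ⟨(Place.continuous_act τ).measurable, map_act_placeMeasure τ⟩

/-- The isometric action of the absolute Galois group on `L¹(Y, λ)`. -/
noncomputable def galoisIsometry (τ : AbsGal) : L1 →ₗᵢ[ℚ] L1 :=
  Lp.compMeasurePreservingₗᵢ ℚ (Place.act τ⁻¹) (measurePreserving_act τ⁻¹)

theorem logAbs_mul (α β : QBarˣ) : logAbs (α * β) = logAbs α + logAbs β := by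
  funext y
  have h : ∀ γ : QBarˣ, y.abv (γ : QBar) ≠ 0 := fun γ => y.abv.ne_zero γ.ne_zero
  rw [Pi.add_apply, logAbs, logAbs, logAbs, Units.val_mul, map_mul, Real.log_mul (h α) (h β)]

theorem toL1_mul (α β : QBarˣ) : toL1 (α * β) = toL1 α + toL1 β := by
  rw [toL1, toL1, toL1, ← MemLp.toLp_add (memLp_logAbs α) (memLp_logAbs β)]
  congr 1
  exact logAbs_mul α β

/-- `α ↦ f_α` as a homomorphism. -/
noncomputable def toL1Hom : Additive QBarˣ →+ L1 :=
  AddMonoidHom.mk' (fun α => toL1 α.toMul) fun α β => toL1_mul α.toMul β.toMul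

/-- The set `𝓕` as a `ℚ`-linear subspace. -/
noncomputable def heightSubmodule : Submodule ℚ L1 where
  carrier := heightFunctions
  zero_mem' := ⟨1, toL1Hom.map_zero⟩
  add_mem' := by
    rintro _ _ ⟨α, rfl⟩ ⟨β, rfl⟩
    exact ⟨α * β, toL1_mul α β⟩
  smul_mem' := by
    rintro q _ ⟨α, rfl⟩
    -- With `q = num / den`, any `den`-th root `b` of `α ^ num` satisfies `f_b = q f_α`.
    obtain ⟨b, hb⟩ := IsAlgClosed.exists_pow_nat_eq ((α ^ q.num : QBarˣ) : QBar) q.den_pos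
    have hb0 : b ≠ 0 := by
      rintro rfl
      rw [zero_pow q.den_nz] at hb
      exact (Units.ne_zero _) hb.symm
    refine ⟨Units.mk0 b hb0, ?_⟩
    have h1 : Units.mk0 b hb0 ^ q.den = α ^ q.num := Units.ext hb
    have h2 : q.den • toL1 (Units.mk0 b hb0) = q.num • toL1 α := by
      have := congrArg (fun γ => toL1Hom (Additive.ofMul γ)) h1
      simp only [ofMul_pow, ofMul_zpow, map_nsmul, map_zsmul] at this
      exact this
    have hd : (q.den : ℚ) ≠ 0 := by exact_mod_cast q.den_nz
    rw [← Nat.cast_smul_eq_nsmul ℚ, ← Int.cast_smul_eq_zsmul ℚ] at h2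
    conv_rhs => rw [← Rat.num_div_den q, div_eq_inv_mul, mul_smul, ← h2, inv_smul_smul₀ hd]

/-- `f_α` as an element of the space `𝓕`. -/
noncomputable def heightVector (α : QBarˣ) : heightSubmodule := ⟨toL1 α, α, rfl⟩

theorem heightVector_surjective : Function.Surjective heightVector := by
  rintro ⟨_, α, rfl⟩
  exact ⟨α, rfl⟩

theorem heightVector_prod {ι : Type*} (s : Finset ι) (α : ι → QBarˣ) :
    heightVector (∏ i ∈ s, α i) = ∑ i ∈ s, heightVector (α i) := by
  refine Subtype.ext ?_
  rw [AddSubmonoidClass.coe_finsetSum]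
  have := map_sum toL1Hom (fun i => Additive.ofMul (α i)) s
  rwa [← ofMul_prod] at this

/-- Because `‖α‖_{τ⁻¹ y} = ‖τ α‖_y`, the isometry sends `f_α` to `f_{τα}`; the equality is
definitional. -/
theorem galoisIsometry_mem (τ : AbsGal) (v : heightSubmodule) :
    galoisIsometry τ v ∈ heightSubmodule := by
  obtain ⟨α, rfl⟩ := heightVector_surjective v
  exact ⟨τ • α, rfl⟩

noncomputable instance : SMul AbsGal heightSubmodule :=
  ⟨fun τ v => ⟨galoisIsometry τ v, galoisIsometry_mem τ v⟩⟩

theorem smul_heightVector (τ : AbsGal) (α : QBarˣ) :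
    τ • heightVector α = heightVector (τ • α) := rfl

noncomputable instance : DistribMulAction AbsGal heightSubmodule where
  one_smul v := by
    obtain ⟨α, rfl⟩ := heightVector_surjective v
    rw [smul_heightVector, one_smul]
  mul_smul σ τ v := by
    obtain ⟨α, rfl⟩ := heightVector_surjective v
    rw [smul_heightVector, smul_heightVector, smul_heightVector, mul_smul]
  smul_zero τ := Subtype.ext (map_zero (galoisIsometry τ))
  smul_add τ v w := Subtype.ext (map_add (galoisIsometry τ) (v : L1) w)

theorem norm_galois_smul (τ : AbsGal) (v : heightSubmodule) : ‖τ • v‖ = ‖v‖ :=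
  (galoisIsometry τ).norm_map v

/-- All conjugates of `α` are roots of its minimal polynomial over `ℚ`. -/
theorem finite_orbit_units (H : Subgroup AbsGal) (α : QBarˣ) : (orbit H α).Finite := by
  refine Set.Finite.of_finite_image (f := Units.val)
    (((minpoly ℚ (α : QBar)).rootSet_finite QBar).subset ?_) Units.val_injective.injOn
  rintro _ ⟨_, ⟨τ, rfl⟩, rfl⟩
  rw [Polynomial.mem_rootSet]
  refine ⟨minpoly.ne_zero (Algebra.IsIntegral.isIntegral _), ?_⟩
  change Polynomial.aeval ((τ : AbsGal) (α : QBar)) _ = 0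
  rw [← AlgEquiv.coe_toAlgHom, Polynomial.aeval_algHom_apply, minpoly.aeval, map_zero]

theorem finite_orbit_heightSubmodule (H : Subgroup AbsGal) (v : heightSubmodule) :
    (orbit H v).Finite := by
  obtain ⟨α, rfl⟩ := heightVector_surjective v
  refine ((finite_orbit_units H α).image heightVector).subset ?_
  rintro _ ⟨τ, rfl⟩
  exact ⟨τ • α, ⟨τ, rfl⟩, rfl⟩

/-! ### The projections attached to fields -/

/-- The projection of `𝓕` onto the vectors fixed by `Aut(QBar / K)`. -/
noncomputable def fieldProjection (K : IntermediateField ℚ QBar) :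
    heightSubmodule →ₗ[ℚ] heightSubmodule :=
  orbitAverageLinear K.fixingSubgroup (finite_orbit_heightSubmodule _)

theorem continuous_fieldProjection (K : IntermediateField ℚ QBar) :
    Continuous (fieldProjection K) :=
  AddMonoidHomClass.continuous_of_bound (fieldProjection K) 1 fun v => by
    rw [one_mul]
    exact norm_orbitAverage_le (finite_orbit_heightSubmodule _)
      (fun τ w => norm_galois_smul τ w) v

theorem isIdempotentElem_fieldProjection (K : IntermediateField ℚ QBar) :
    IsIdempotentElem (fieldProjection K : Module.End ℚ heightSubmodule) :=
  LinearMap.ext fun v => orbitAverage_of_fixed fun τ =>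
    smul_orbitAverage (finite_orbit_heightSubmodule K.fixingSubgroup) τ v

theorem fieldProjection_heightVector {K : IntermediateField ℚ QBar} {α : QBarˣ}
    (hα : (α : QBar) ∈ K) : fieldProjection K (heightVector α) = heightVector α := by
  refine orbitAverage_of_fixed fun τ => ?_
  have : τ • α = α := Units.ext (τ.2 ⟨α, hα⟩)
  exact congrArg heightVector this

/-- The average of `f_α` may be taken over the orbit of `α` itself instead of that of `f_α`. It is
then a rational multiple of `f_β`, with `β` the product of the conjugates of `α` over `K`. -/
theorem fieldProjection_mem_heightSpan (K : IntermediateField ℚ QBar) (v : heightSubmodule) :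
    (fieldProjection K v : L1) ∈ heightSpan K := by
  obtain ⟨α, rfl⟩ := heightVector_surjective v
  have := (finite_orbit_units K.fixingSubgroup α).fintype
  have h := average_eq_orbitAverage (G := K.fixingSubgroup)
    (fun x : orbit K.fixingSubgroup α => heightVector x) (fun _ _ => rfl) ⟨α, mem_orbit_self α⟩
  rw [← heightVector_prod] at h
  change ((orbitAverage K.fixingSubgroup (heightVector α) : heightSubmodule) : L1) ∈ _
  rw [← h]
  refine (heightSpan K).smul_mem _ (Submodule.subset_span ⟨_, ?_, rfl⟩)
  -- By infinite Galois theory, `β ∈ K` as soon as `β` is fixed by `Aut(QBar / K)`, whose elements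
  -- only permute the factors.
  refine (InfiniteGalois.fixedField_fixingSubgroup K).le fun τ => ?_
  change ((τ • ∏ x : orbit K.fixingSubgroup α, (x : QBarˣ) : QBarˣ) : QBar) = _
  rw [Finset.smul_prod']
  exact congrArg Units.val (Equiv.prod_comp
    (MulAction.toPerm τ : Equiv.Perm (orbit K.fixingSubgroup α)) fun x => (x : QBarˣ))

theorem map_range_fieldProjection (K : IntermediateField ℚ QBar) :
    (LinearMap.range (fieldProjection K)).map heightSubmodule.subtype = heightSpan K := by
  refine le_antisymm ?_ (Submodule.span_le.2 ?_)
  · rintro _ ⟨_, ⟨v, rfl⟩, rfl⟩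
    exact fieldProjection_mem_heightSpan K v
  · rintro _ ⟨α, hα, rfl⟩
    exact ⟨_, ⟨heightVector α, rfl⟩, by rw [fieldProjection_heightVector hα]; rfl⟩

/-- An automorphism fixing `L` fixes `F`, hence maps the normal extension `K` of `F` into itself;
conjugation by it then preserves the group fixing `K`. -/
theorem fixingSubgroup_le_normalizer {F K L : IntermediateField ℚ QBar} (hFK : F ≤ K)
    (hFL : F ≤ L) [Normal F (IntermediateField.extendScalars hFK)] :
    L.fixingSubgroup ≤ Subgroup.normalizer (K.fixingSubgroup : Set AbsGal) := by
  have hstable : ∀ τ ∈ L.fixingSubgroup, ∀ x ∈ K, τ x ∈ K := by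
    intro τ hτ x hx
    have hτF : τ ∈ F.fixingSubgroup := IntermediateField.fixingSubgroup_le hFL hτ
    have h := IntermediateField.normal_iff_forall_map_le'.1
      ‹Normal F (IntermediateField.extendScalars hFK)› (F.fixingSubgroupEquiv ⟨τ, hτF⟩)
    exact h ⟨x, hx, rfl⟩
  have hconj : ∀ τ ∈ L.fixingSubgroup, ∀ σ ∈ K.fixingSubgroup,
      τ * σ * τ⁻¹ ∈ K.fixingSubgroup := by
    rintro τ hτ σ hσ ⟨x, hx⟩
    have h : σ (τ⁻¹ x) = τ⁻¹ x := hσ ⟨_, hstable _ (inv_mem hτ) x hx⟩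
    change τ (σ (τ⁻¹ x)) = x
    rw [h]
    exact τ.apply_symm_apply x
  intro τ hτ
  rw [Subgroup.mem_normalizer_iff]
  refine fun σ => ⟨hconj τ hτ σ, fun h => ?_⟩
  simpa [mul_assoc] using hconj τ⁻¹ (inv_mem hτ) _ h

theorem commute_fieldProjection {F K L : IntermediateField ℚ QBar} (hFK : F ≤ K)
    (hFL : F ≤ L) [Normal F (IntermediateField.extendScalars hFK)] :
    Commute (fieldProjection K : Module.End ℚ heightSubmodule) (fieldProjection L) :=
  LinearMap.ext fun v => (orbitAverage_comm _ _ (fixingSubgroup_le_normalizer hFK hFL)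
    (finite_orbit_heightSubmodule _) (finite_orbit_heightSubmodule _) v).symm

/-- Relatively closed subspaces of `𝓕` are `𝓕`-closed. -/
theorem isHeightClosed_map_subtype {S : Submodule ℚ heightSubmodule}
    (hS : IsClosed (S : Set heightSubmodule)) :
    IsHeightClosed (S.map heightSubmodule.subtype : Set L1) := by
  refine Set.Subset.antisymm (fun x hx => ⟨?_, subset_closure hx⟩) ?_
  · obtain ⟨v, _, rfl⟩ := hx
    exact v.2
  · rintro x ⟨hx, hcl⟩
    have h : (⟨x, hx⟩ : heightSubmodule) ∈ closure (S : Set heightSubmodule) :=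
      closure_subtype.2 hcl
    rw [hS.closure_eq] at h
    exact ⟨_, h, rfl⟩

end WeilHeight

theorem theorem2p2 (N : ℕ) (K : Fin N → IntermediateField ℚ WeilHeight.QBar)
    (hK : ∀ i j : Fin N, i ≠ j →
      IsGalois ↥(K i ⊓ K j) (IntermediateField.extendScalars (inf_le_left : K i ⊓ K j ≤ K i)) ∨
      IsGalois ↥(K i ⊓ K j) (IntermediateField.extendScalars (inf_le_right : K i ⊓ K j ≤ K j))) :
    WeilHeight.IsHeightClosed
      ((⨆ i : Fin N, WeilHeight.heightSpan (K i) : Submodule ℚ WeilHeight.L1) :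
        Set WeilHeight.L1) := by
  have hcomm : ∀ i j, Commute
      (WeilHeight.fieldProjection (K i) : Module.End ℚ WeilHeight.heightSubmodule)
      (WeilHeight.fieldProjection (K j)) := by
    intro i j
    rcases eq_or_ne i j with rfl | hij
    · exact Commute.refl _
    · rcases hK i j hij with h | h
      -- The role of `F` is played by the intersection. Commuting is symmetric, so it does not
      -- matter which of the two extensions is Galois.
      · exact WeilHeight.commute_fieldProjection inf_le_left inf_le_right
      · exact (WeilHeight.commute_fieldProjection inf_le_right inf_le_left).symm
  have h := WeilHeight.isHeightClosed_map_subtype (isClosed_iSup_range_of_commute _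
    (fun i => WeilHeight.continuous_fieldProjection (K i))
    (fun i => WeilHeight.isIdempotentElem_fieldProjection (K i)) hcomm)
  rw [Submodule.map_iSup] at h
  simpa only [WeilHeight.map_range_fieldProjection] using h
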